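/- Let $|0\rangle,|1\rangle,|2\rangle$ be the standard basis of $\mathbb{C}^3$ and $|\mathbf 0\rangle,\dots,|\mathbf 5\rangle$ that of $\mathbb{C}^6$; write $|a\pm b\rangle$ for $|a\rangle\pm|b\rangle$, etc. (states are written up to normalization). Let $\mathcal{G}_4$ be the set of the following $27$ states in $\mathbb{C}^3\otimes\mathbb{C}^3\otimes\mathbb{C}^6$, shared by Alice, Bob and Charlie in this order (in each expression all signs $\pm$ are equal): $$\begin{aligned} &|0\rangle|1\rangle|\mathbf 0\pm\mathbf 1+\mathbf 4\pm\mathbf 5\rangle,\quad |0\rangle|2\rangle|\mathbf 0\pm\mathbf 2+\mathbf 4\pm\mathbf 3\rangle,\quad |1\rangle|2\rangle|\mathbf 0\pm\mathbf 1+\mathbf 4\pm\mathbf 5\rangle,\quad |2\rangle|1\rangle|\mathbf 0\pm\mathbf 2+\mathbf 4\pm\mathbf 3\rangle,\\ &|0\rangle|0\rangle|\mathbf 0-\mathbf 4\rangle,\quad |1\rangle|0\pm1\rangle|\mathbf 0-\mathbf 4\rangle,\quad |2\rangle|0\pm2\rangle|\mathbf 0-\mathbf 4\rangle,\quad |2\rangle|0\pm1\rangle|\mathbf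 1-\mathbf 5\rangle,\quad |1\rangle|0\pm2\rangle|\mathbf 2-\mathbf 3\rangle,\\ &|1\rangle|1\rangle|\mathbf 1-\mathbf 5\rangle,\quad |0\pm1\rangle|0\rangle|\mathbf 1-\mathbf 5\rangle,\quad |0\pm2\rangle|0\rangle|\mathbf 2-\mathbf 3\rangle,\quad |0\pm1\rangle|1\rangle|\mathbf 2-\mathbf 3\rangle,\quad |0\pm2\rangle|2\rangle|\mathbf 1-\mathbf 5\rangle,\quad |2\rangle|2\rangle|\mathbf 2-\mathbf 3\rangle. \end{aligned}$$ A measurement by one agent is given by finitely many operators $K_o$ on that agent's system with $\sum_o K_o^\dagger K_o=I$; it is orthogonality preserving for a set of states if for every outcome the post-measurement states are mutually orthogonal (some of them may vanish). A set of (nonzero) orthogonal states is locally irreducible in a bipartition if no finite, possibly adaptive, protocol of orthogonality preserving measurements, each performed by one of the two sides, has an outcome of nonzero probability for some state of the set that eliminates (has probability zero for) another state of the set. Then: (i) $\mathcal{G}_4$ is a set of orthogonal product states which is perfectly distinguishable by local operations and classical communication (a finite-round protocol) among the three separated parties. (ii) The measurement by Charlie alone consisting of the orthogonal projections $K_1,K_2$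 onto $\mathrm{span}\{|\mathbf 0\rangle,|\mathbf 1\rangle,|\mathbf 2\rangle\}$ and $\mathrm{span}\{|\mathbf 3\rangle,|\mathbf 4\rangle,|\mathbf 5\rangle\}$ is orthogonality preserving for $\mathcal{G}_4$. For each of its two outcomes, the post-measurement states are $27$ nonzero, mutually orthogonal product states, and this set is locally irreducible in every bipartition $A|BC$, $B|CA$, $C|AB$ (strong quantum nonlocality without entanglement). The sets obtained for the two outcomes coincide up to a unitary of Charlie, normalization and phases of the states. Hence the locally distinguishable set $\mathcal{G}_4$ is transformed deterministically, by a single local orthogonality preserving measurement at Charlie's site, into an orthogonal product set that is locally irreducible in every bipartition. -/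

import Mathlib

open scoped Matrix Kronecker

noncomputable section

namespace LocalStates

/-! ### Measurements, orthogonality and local elimination

A finite dimensional system with orthonormal basis indexed by `T` has state space `T → ℂ`.
State vectors are not normalized, so a state whose vector becomes `0` under a measurement operator
is a state for which that outcome has probability zero.  The agents who share the system are
described by the family `ops : P → Set (Matrix T T ℂ)`, where `ops p` is the set of all operators
that agent `p` can apply to the system. -/

section General

variable {T I P : Type*} [Fintype T] [DecidableEq T]

/-- A set of nonzero, mutually orthogonal vectors. -/
def IsOrthogonalSet (ψ : I → T → ℂ) : Prop :=
  (∀ i, ψ i ≠ 0) ∧ ∀ i j, i ≠ j → star (ψ i) ⬝ᵥ ψ j = 0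

/-- A measurement with measurement operators `K o`, all of them in the set `A` of operators
available to one agent: `∑ₒ (K o)† K o = 1`. -/
structure IsMeasurement (A : Set (Matrix T T ℂ)) {n : ℕ} (K : Fin n → Matrix T T ℂ) : Prop where
  mem : ∀ o, K o ∈ A
  complete : ∑ o, (K o)ᴴ * K o = 1

/-- An orthogonality preserving measurement for `ψ`: for every outcome the (unnormalized)
post-measurement states are mutually orthogonal.  Some of them may vanish. -/
structure IsOPM (A : Set (Matrix T T ℂ)) {n : ℕ} (K : Fin n → Matrix T T ℂ) (ψ : I → T → ℂ) :
    Prop extends IsMeasurement A K where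
  orthogonal : ∀ o i j, i ≠ j → star (K o *ᵥ ψ i) ⬝ᵥ (K o *ᵥ ψ j) = 0

/-- `OPReachable ops ψ φ`: the family `φ` is what `ψ` has become along one branch of a
(multi-round, adaptive) protocol in which every step is an orthogonality preserving measurement
performed by one of the agents. -/
inductive OPReachable (ops : P → Set (Matrix T T ℂ)) (ψ : I → T → ℂ) : (I → T → ℂ) → Prop
  | refl : OPReachable ops ψ ψ
  | step {φ : I → T → ℂ} (h : OPReachable ops ψ φ) (p : P) {n : ℕ} (K : Fin n → Matrix T T ℂ)
      (hK : IsOPM (ops p) K φ) (o : Fin n) : OPReachable ops ψ (fun i => K o *ᵥ φ i)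

/-- Local irreducibility of a set of orthogonal states: no protocol of orthogonality preserving
local measurements has an outcome that can occur (some state survives) and that eliminates
a member of the set. -/
def LocallyIrreducible (ops : P → Set (Matrix T T ℂ)) (ψ : I → T → ℂ) : Prop :=
  IsOrthogonalSet ψ ∧
    ∀ φ : I → T → ℂ, OPReachable ops ψ φ → (∃ i, φ i ≠ 0) → ∀ i, φ i ≠ 0

/-- Perfect distinguishability by local operations and classical communication: there is a finite
protocol tree of local measurements, the agent and the measurement at every node depending on the
previous outcomes, such that at every leaf at most one of the states has nonzero probability. -/
inductive LocallyDistinguishable (ops : P → Set (Matrix T T ℂ)) : (I → T → ℂ) → Prop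
  | done (ψ : I → T → ℂ) (h : ∀ i j, i ≠ j → ψ i = 0 ∨ ψ j = 0) : LocallyDistinguishable ops ψ
  | step (ψ : I → T → ℂ) (p : P) {n : ℕ} (K : Fin n → Matrix T T ℂ)
      (hK : IsMeasurement (ops p) K)
      (h : ∀ o, LocallyDistinguishable ops (fun i => K o *ᵥ ψ i)) : LocallyDistinguishable ops ψ

end General

/-! ### Three parties: Alice, Bob, Charlie -/

section Tripartite

variable (α β γ : Type*) [Fintype α] [Fintype β] [Fintype γ]
  [DecidableEq α] [DecidableEq β] [DecidableEq γ]

/-- Operators `M ⊗ 1 ⊗ 1`. -/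
def opsA : Set (Matrix (α × β × γ) (α × β × γ) ℂ) :=
  Set.range fun M : Matrix α α ℂ => M ⊗ₖ ((1 : Matrix β β ℂ) ⊗ₖ (1 : Matrix γ γ ℂ))

/-- Operators `1 ⊗ M ⊗ 1`. -/
def opsB : Set (Matrix (α × β × γ) (α × β × γ) ℂ) :=
  Set.range fun M : Matrix β β ℂ => (1 : Matrix α α ℂ) ⊗ₖ (M ⊗ₖ (1 : Matrix γ γ ℂ))

/-- Operators `1 ⊗ 1 ⊗ M`. -/
def opsC : Set (Matrix (α × β × γ) (α × β × γ) ℂ) :=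
  Set.range fun M : Matrix γ γ ℂ => (1 : Matrix α α ℂ) ⊗ₖ ((1 : Matrix β β ℂ) ⊗ₖ M)

/-- Joint operators of Bob and Charlie. -/
def opsBC : Set (Matrix (α × β × γ) (α × β × γ) ℂ) :=
  Set.range fun M : Matrix (β × γ) (β × γ) ℂ => (1 : Matrix α α ℂ) ⊗ₖ M

/-- Joint operators of Charlie and Alice. -/
def opsCA : Set (Matrix (α × β × γ) (α × β × γ) ℂ) :=
  Set.range fun M : Matrix (γ × α) (γ × α) ℂ =>
    Matrix.of fun i j => M (i.2.2, i.1) (j.2.2, j.1) * (1 : Matrix β β ℂ) i.2.1 j.2.1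

/-- Joint operators of Alice and Bob. -/
def opsAB : Set (Matrix (α × β × γ) (α × β × γ) ℂ) :=
  Set.range fun M : Matrix (α × β) (α × β) ℂ =>
    Matrix.of fun i j => M (i.1, i.2.1) (j.1, j.2.1) * (1 : Matrix γ γ ℂ) i.2.2 j.2.2

/-- All three parties are separated. -/
def separated : Fin 3 → Set (Matrix (α × β × γ) (α × β × γ) ℂ) :=
  ![opsA α β γ, opsB α β γ, opsC α β γ]

/-- The three bipartitions `A|BC`, `B|CA` and `C|AB`, each with its two agents. -/
def bipartition : Fin 3 → Fin 2 → Set (Matrix (α × β × γ) (α × β × γ) ℂ) :=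
  ![![opsA α β γ, opsBC α β γ], ![opsB α β γ, opsCA α β γ], ![opsC α β γ, opsAB α β γ]]

variable {α β γ}

/-- The product vector `a ⊗ b ⊗ c`. -/
def prod3 (a : α → ℂ) (b : β → ℂ) (c : γ → ℂ) : α × β × γ → ℂ :=
  fun x => a x.1 * b x.2.1 * c x.2.2

/-- Fully product vectors. -/
def IsProduct (v : α × β × γ → ℂ) : Prop :=
  ∃ a b c, v = prod3 a b c

/-- Irreducibility in every bipartition. -/
def IrreducibleInEveryBipartition {I : Type*} (ψ : I → α × β × γ → ℂ) : Prop :=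
  ∀ b, LocallyIrreducible (bipartition α β γ b) ψ

end Tripartite

/-! ### The set of 27 states and Charlie's measurement -/

/-- Standard basis vector. -/
def ket {n : ℕ} (k : Fin n) : Fin n → ℂ := Pi.single k 1

/-- The 27 (unnormalized) states in `ℂ³ ⊗ ℂ³ ⊗ ℂ⁶`. -/
def G4 : Fin 27 → Fin 3 × Fin 3 × Fin 6 → ℂ :=
  ![prod3 (ket 0) (ket 1) (ket 0 + ket 1 + ket 4 + ket 5),
    prod3 (ket 0) (ket 1) (ket 0 - ket 1 + ket 4 - ket 5),
    prod3 (ket 0) (ket 2) (ket 0 + ket 2 + ket 4 + ket 3),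
    prod3 (ket 0) (ket 2) (ket 0 - ket 2 + ket 4 - ket 3),
    prod3 (ket 1) (ket 2) (ket 0 + ket 1 + ket 4 + ket 5),
    prod3 (ket 1) (ket 2) (ket 0 - ket 1 + ket 4 - ket 5),
    prod3 (ket 2) (ket 1) (ket 0 + ket 2 + ket 4 + ket 3),
    prod3 (ket 2) (ket 1) (ket 0 - ket 2 + ket 4 - ket 3),
    prod3 (ket 0) (ket 0) (ket 0 - ket 4),
    prod3 (ket 1) (ket 0 + ket 1) (ket 0 - ket 4),
    prod3 (ket 1) (ket 0 - ket 1) (ket 0 - ket 4),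
    prod3 (ket 2) (ket 0 + ket 2) (ket 0 - ket 4),
    prod3 (ket 2) (ket 0 - ket 2) (ket 0 - ket 4),
    prod3 (ket 2) (ket 0 + ket 1) (ket 1 - ket 5),
    prod3 (ket 2) (ket 0 - ket 1) (ket 1 - ket 5),
    prod3 (ket 1) (ket 0 + ket 2) (ket 2 - ket 3),
    prod3 (ket 1) (ket 0 - ket 2) (ket 2 - ket 3),
    prod3 (ket 1) (ket 1) (ket 1 - ket 5),
    prod3 (ket 0 + ket 1) (ket 0) (ket 1 - ket 5),
    prod3 (ket 0 - ket 1) (ket 0) (ket 1 - ket 5),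
    prod3 (ket 0 + ket 2) (ket 0) (ket 2 - ket 3),
    prod3 (ket 0 - ket 2) (ket 0) (ket 2 - ket 3),
    prod3 (ket 0 + ket 1) (ket 1) (ket 2 - ket 3),
    prod3 (ket 0 - ket 1) (ket 1) (ket 2 - ket 3),
    prod3 (ket 0 + ket 2) (ket 2) (ket 1 - ket 5),
    prod3 (ket 0 - ket 2) (ket 2) (ket 1 - ket 5),
    prod3 (ket 2) (ket 2) (ket 2 - ket 3)]

/-- An operator of Charlie alone on `ℂ³ ⊗ ℂ³ ⊗ ℂ⁶`. -/
def onCharlie (M : Matrix (Fin 6) (Fin 6) ℂ) :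
    Matrix (Fin 3 × Fin 3 × Fin 6) (Fin 3 × Fin 3 × Fin 6) ℂ :=
  (1 : Matrix (Fin 3) (Fin 3) ℂ) ⊗ₖ ((1 : Matrix (Fin 3) (Fin 3) ℂ) ⊗ₖ M)

/-- Charlie's projective measurement: outcome `0` projects his system onto the span of the basis
vectors `0, 1, 2`, outcome `1` onto the span of `3, 4, 5`. -/
def charlieMeasurement :
    Fin 2 → Matrix (Fin 3 × Fin 3 × Fin 6) (Fin 3 × Fin 3 × Fin 6) ℂ :=
  ![onCharlie (Matrix.diagonal ![1, 1, 1, 0, 0, 0]),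
    onCharlie (Matrix.diagonal ![0, 0, 0, 1, 1, 1])]

/-- The (unnormalized) states after outcome `o` of Charlie's measurement. -/
def postMeasurement (o : Fin 2) : Fin 27 → Fin 3 × Fin 3 × Fin 6 → ℂ :=
  fun i => charlieMeasurement o *ᵥ G4 i

end LocalStates

end

open LocalStates

/-!
The integer vectors underlying `G4` make orthogonality, the tensor factors and the comparison of
the two outcomes of Charlie's measurement finite checks, done by `decide`.

*Distinguishability.*  Charlie first finds out whether his state is `|0⟩ - |4⟩`, `|1⟩ - |5⟩` or
`|2⟩ - |3⟩`, or one of the states with four terms, which are orthogonal to these three.  In each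
of the four cases the remaining states can be separated by further projections onto a line; every
projection is chosen such that each remaining state is either kept or annihilated
(`Distinguishable.of_alice`, `of_bob`, `of_charlie`), so a finite tree of them isolates each state
(`locallyDistinguishable_G4`).

*Irreducibility.*  After Charlie's measurement the states span a copy of `ℂ³ ⊗ ℂ³ ⊗ ℂ³`, with the
27 basis vectors as the cells of a cube.  The 27 states are, up to sign, the vectors `|x⟩ ± |y⟩`
for the dominoes `{x, y}` of a tiling of the cube by twelve dominoes and the three single cells
`000`, `111`, `222`.  An operator `E` with `⟨ψᵢ|E|ψⱼ⟩ = 0` for `i ≠ j` therefore has no matrix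
elements between different dominoes, and has equal diagonal entries on the two cells of a domino
(`apply_cell_eq_zero`, `apply_cell_eq`).  If `E = 1 ⊗ M` acts on two parties only, comparing the
layers of the cube at the idle party shows that `M` is diagonal, and moving along dominoes that
its diagonal is constant (`isRigid_of_layers`).  So every orthogonality preserving measurement of
two parties, and a fortiori of one, is trivial on the span of the states.  The measurement
operators then act there as multiples of isometries, which preserve all inner products up to a
common factor; by induction along the protocol either all states survive or all vanish
(`IsTrivialImage.step`, `locallyIrreducible_of_isRigid`).
-/

namespace LocalStates

/-! ### A criterion for local irreducibility -/

section Criterion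

variable {T I : Type*} [Fintype T]

/-- Measurements with operators in `A` are trivial on the range of `Q`: an operator `E ∈ A` (such
as an effect `Kᴴ * K`) for which the states `ψ` remain orthogonal is a scalar on that range. -/
def IsRigid (A : Set (Matrix T T ℂ)) (Q : Matrix T T ℂ) (ψ : I → T → ℂ) : Prop :=
  ∀ E ∈ A, (∀ i j, i ≠ j → star (ψ i) ⬝ᵥ (E *ᵥ ψ j) = 0) → ∃ c : ℂ, Q * E * Q = c • Q

theorem IsRigid.mono {A B : Set (Matrix T T ℂ)} {Q : Matrix T T ℂ} {ψ : I → T → ℂ}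
    (h : IsRigid B Q ψ) (hAB : A ⊆ B) : IsRigid A Q ψ :=
  fun E hE => h E (hAB hE)

theorem star_mulVec_dotProduct_mulVec (M N : Matrix T T ℂ) (v w : T → ℂ) :
    star (M *ᵥ v) ⬝ᵥ (N *ᵥ w) = star v ⬝ᵥ ((Mᴴ * N) *ᵥ w) := by
  rw [Matrix.star_mulVec, ← Matrix.dotProduct_mulVec, Matrix.mulVec_mulVec]

theorem dotProduct_compress {Q : Matrix T T ℂ} {ψ : I → T → ℂ} (hQ : Qᴴ = Q) (hψ : ∀ i, Q *ᵥ ψ i = ψ i)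
    (E : Matrix T T ℂ) (i j : I) :
    star (ψ i) ⬝ᵥ ((Q * E * Q) *ᵥ ψ j) = star (ψ i) ⬝ᵥ (E *ᵥ ψ j) := by
  rw [mul_assoc, ← congrArg (· * (E * Q)) hQ, ← star_mulVec_dotProduct_mulVec, hψ,
    ← Matrix.mulVec_mulVec, hψ]

variable [DecidableEq T]

/-- The commuting operator algebras of two agents, together with a projection `Q` (the support of
the states) that respects the splitting. -/
structure IsSplitting (A B : Set (Matrix T T ℂ)) (Q : Matrix T T ℂ) : Prop where
  one_left : 1 ∈ A
  one_right : 1 ∈ B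
  mul_left : ∀ X ∈ A, ∀ Y ∈ A, X * Y ∈ A
  mul_right : ∀ X ∈ B, ∀ Y ∈ B, X * Y ∈ B
  star_left : ∀ X ∈ A, Xᴴ ∈ A
  star_right : ∀ X ∈ B, Xᴴ ∈ B
  comm : ∀ X ∈ A, ∀ Y ∈ B, X * Y = Y * X
  isHermitian : Qᴴ = Q
  idem : Q * Q = Q
  support : Q ∈ A ∪ B

variable {A B : Set (Matrix T T ℂ)} {Q : Matrix T T ℂ} {ψ : I → T → ℂ}

theorem IsSplitting.symm (h : IsSplitting A B Q) : IsSplitting B A Q where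
  one_left := h.one_right
  one_right := h.one_left
  mul_left := h.mul_right
  mul_right := h.mul_left
  star_left := h.star_right
  star_right := h.star_left
  comm X hX Y hY := (h.comm Y hY X hX).symm
  isHermitian := h.isHermitian
  idem := h.idem
  support := h.support.symm

theorem IsSplitting.compress_mul (h : IsSplitting A B Q) {E F : Matrix T T ℂ} (hE : E ∈ A)
    (hF : F ∈ B) {d : ℂ} (hd : Q * F * Q = d • Q) : Q * (E * F) * Q = d • (Q * E * Q) := by
  rcases h.support with hQ | hQ
  · calc Q * (E * F) * Q = Q * E * (F * (Q * Q)) := by rw [h.idem]; simp only [mul_assoc]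
      _ = Q * E * (Q * F * Q) := by rw [← mul_assoc F, ← h.comm Q hQ F hF]
      _ = d • (Q * E * Q) := by rw [hd, mul_smul_comm]
  · calc Q * (E * F) * Q = ((Q * Q) * E) * F * Q := by rw [h.idem]; simp only [mul_assoc]
      _ = (Q * (E * Q)) * F * Q := by rw [mul_assoc Q, ← h.comm E hE Q hQ]
      _ = Q * E * (Q * F * Q) := by simp only [mul_assoc]
      _ = d • (Q * E * Q) := by rw [hd, mul_smul_comm]

/-- What a protocol of orthogonality preserving measurements can do to rigid states: either they
have all vanished, or each agent has applied a nonzero multiple of an isometry of the support. -/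
def IsTrivialImage (A B : Set (Matrix T T ℂ)) (Q : Matrix T T ℂ) (ψ φ : I → T → ℂ) : Prop :=
  (∀ i, φ i = 0) ∨ ∃ X ∈ A, ∃ Y ∈ B, ∃ c d : ℂ, c ≠ 0 ∧ d ≠ 0 ∧
    Q * (Xᴴ * X) * Q = c • Q ∧ Q * (Yᴴ * Y) * Q = d • Q ∧ ∀ i, φ i = (X * Y) *ᵥ ψ i

theorem IsTrivialImage.symm (h : IsSplitting A B Q) {φ : I → T → ℂ}
    (hφ : IsTrivialImage A B Q ψ φ) : IsTrivialImage B A Q ψ φ := by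
  rcases hφ with h0 | ⟨X, hX, Y, hY, c, d, hc, hd, hXc, hYd, hφ⟩
  · exact Or.inl h0
  · exact Or.inr ⟨Y, hY, X, hX, d, c, hd, hc, hYd, hXc, fun i => by rw [hφ, h.comm X hX Y hY]⟩

/-- Since `X` and `Y` commute, `(XY)†(XY) = X†X Y†Y`, which is `d X†X` on the support. -/
theorem IsSplitting.dotProduct_image (h : IsSplitting A B Q) (hψ : ∀ i, Q *ᵥ ψ i = ψ i)
    {X Y : Matrix T T ℂ} (hX : X ∈ A) (hY : Y ∈ B) {d : ℂ} (hd : Q * (Yᴴ * Y) * Q = d • Q)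
    (i j : I) :
    star ((X * Y) *ᵥ ψ i) ⬝ᵥ ((X * Y) *ᵥ ψ j) = d * (star (ψ i) ⬝ᵥ ((Xᴴ * X) *ᵥ ψ j)) := by
  have hE : Xᴴ * X ∈ A := h.mul_left _ (h.star_left _ hX) _ hX
  have hF : Yᴴ * Y ∈ B := h.mul_right _ (h.star_right _ hY) _ hY
  have hXY : (X * Y)ᴴ * (X * Y) = Xᴴ * X * (Yᴴ * Y) := by
    rw [Matrix.conjTranspose_mul, ← mul_assoc (Xᴴ * X), h.comm _ hE _ (h.star_right _ hY)]
    simp only [mul_assoc]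
  rw [star_mulVec_dotProduct_mulVec, hXY, ← dotProduct_compress h.isHermitian hψ,
    h.compress_mul hE hF hd, Matrix.smul_mulVec, dotProduct_smul,
    dotProduct_compress h.isHermitian hψ, smul_eq_mul]

open ComplexOrder in
theorem IsTrivialImage.step (h : IsSplitting A B Q) (hψ : ∀ i, Q *ᵥ ψ i = ψ i)
    (hA : IsRigid A Q ψ) {φ : I → T → ℂ} (hφ : IsTrivialImage A B Q ψ φ) {n : ℕ}
    {K : Fin n → Matrix T T ℂ} (hK : IsOPM A K φ) (o : Fin n) :
    IsTrivialImage A B Q ψ fun i => K o *ᵥ φ i := by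
  rcases hφ with h0 | ⟨X, hX, Y, hY, c, d, hc, hd, hXc, hYd, hφ⟩
  · exact Or.inl fun i => by simp [h0]
  have hKX : K o * X ∈ A := h.mul_left _ (hK.mem o) _ hX
  have hφ' : ∀ i, K o *ᵥ φ i = ((K o * X) * Y) *ᵥ ψ i := fun i => by
    rw [hφ, Matrix.mulVec_mulVec, mul_assoc]
  obtain ⟨e, he⟩ := hA ((K o * X)ᴴ * (K o * X)) (h.mul_left _ (h.star_left _ hKX) _ hKX)
    fun i j hij => by
      have := hK.orthogonal o i j hij
      rw [hφ', hφ', h.dotProduct_image hψ hKX hY hYd] at this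
      exact (mul_eq_zero.mp this).resolve_left hd
  by_cases he0 : e = 0
  · refine Or.inl fun i => dotProduct_star_self_eq_zero.mp ?_
    change star (K o *ᵥ φ i) ⬝ᵥ (K o *ᵥ φ i) = 0
    rw [hφ', h.dotProduct_image hψ hKX hY hYd,
      ← dotProduct_compress h.isHermitian hψ, he, he0]
    simp
  · exact Or.inr ⟨_, hKX, Y, hY, e, d, he0, hd, he, hYd, hφ'⟩

open ComplexOrder in
theorem locallyIrreducible_of_isRigid (h : IsSplitting A B Q) (hψ : ∀ i, Q *ᵥ ψ i = ψ i)
    (hA : IsRigid A Q ψ) (hB : IsRigid B Q ψ) (horth : IsOrthogonalSet ψ) :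
    LocallyIrreducible ![A, B] ψ := by
  refine ⟨horth, fun φ hφ hne => ?_⟩
  have key : IsTrivialImage A B Q ψ φ := by
    clear hne
    induction hφ with
    | refl =>
      exact Or.inr ⟨1, h.one_left, 1, h.one_right, 1, 1, one_ne_zero, one_ne_zero,
        by simp [h.idem], by simp [h.idem], by simp⟩
    | step _ p K hK o ih =>
      fin_cases p
      · exact ih.step h hψ hA hK o
      · exact ((ih.symm h).step h.symm hψ hB hK o).symm h.symm
  rcases key with h0 | ⟨X, hX, Y, hY, c, d, hc, hd, hXc, hYd, hφ⟩
  · exact absurd hne (by simp [h0])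
  intro i hi
  have := h.dotProduct_image hψ hX hY hYd i i
  rw [← hφ, hi, ← dotProduct_compress h.isHermitian hψ, hXc, Matrix.smul_mulVec, hψ,
    dotProduct_smul, smul_eq_mul, star_zero, zero_dotProduct, eq_comm, mul_eq_zero, mul_eq_zero,
    dotProduct_star_self_eq_zero] at this
  exact this.elim hd fun h' => h'.elim hc (horth.1 i)

end Criterion

/-! ### The operators of two agents sharing a bipartite system -/

section Bipartite

variable {T m n : Type*} [Fintype T] [DecidableEq T] [Fintype m] [DecidableEq m] [Fintype n]
  [DecidableEq n]

/-- The operators `M ⊗ 1` on a system identified with a bipartite one. -/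
def leftOps (g : T ≃ m × n) : Set (Matrix T T ℂ) :=
  Set.range fun M : Matrix m m ℂ => (M ⊗ₖ (1 : Matrix n n ℂ)).submatrix g g

/-- The operators `1 ⊗ M` on a system identified with a bipartite one. -/
def rightOps (g : T ≃ m × n) : Set (Matrix T T ℂ) :=
  Set.range fun M : Matrix n n ℂ => ((1 : Matrix m m ℂ) ⊗ₖ M).submatrix g g

theorem isSplitting_leftOps_rightOps (g : T ≃ m × n) {Q : Matrix T T ℂ} (hQ : Qᴴ = Q)
    (hQQ : Q * Q = Q) (hmem : Q ∈ leftOps g ∪ rightOps g) :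
    IsSplitting (leftOps g) (rightOps g) Q where
  one_left := ⟨1, by simp⟩
  one_right := ⟨1, by simp⟩
  mul_left := by
    rintro _ ⟨M, rfl⟩ _ ⟨N, rfl⟩
    exact ⟨M * N, by simp [Matrix.submatrix_mul_equiv, ← Matrix.mul_kronecker_mul]⟩
  mul_right := by
    rintro _ ⟨M, rfl⟩ _ ⟨N, rfl⟩
    exact ⟨M * N, by simp [Matrix.submatrix_mul_equiv, ← Matrix.mul_kronecker_mul]⟩
  star_left := by
    rintro _ ⟨M, rfl⟩
    exact ⟨Mᴴ, by simp [Matrix.conjTranspose_kronecker]⟩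
  star_right := by
    rintro _ ⟨M, rfl⟩
    exact ⟨Mᴴ, by simp [Matrix.conjTranspose_kronecker]⟩
  comm := by
    rintro _ ⟨M, rfl⟩ _ ⟨N, rfl⟩
    simp [Matrix.submatrix_mul_equiv, ← Matrix.mul_kronecker_mul]
  isHermitian := hQ
  idem := hQQ
  support := hmem

end Bipartite

section Tripartite

variable (α β γ : Type*)

/-- The identification of `A|B|C` with `B|CA`. -/
def equivBCA : α × β × γ ≃ β × (γ × α) where
  toFun x := (x.2.1, x.2.2, x.1)
  invFun y := (y.2.2, y.1, y.2.1)

/-- The identification of `A|B|C` with `C|AB`. -/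
def equivCAB : α × β × γ ≃ γ × (α × β) where
  toFun x := (x.2.2, x.1, x.2.1)
  invFun y := (y.2.1, y.2.2, y.1)

theorem opsA_eq_leftOps [DecidableEq β] [DecidableEq γ] :
    opsA α β γ = leftOps (Equiv.refl (α × β × γ)) := by
  simp [opsA, leftOps]

theorem opsBC_eq_rightOps [DecidableEq α] :
    opsBC α β γ = rightOps (Equiv.refl (α × β × γ)) := rfl

theorem opsB_eq_leftOps [DecidableEq α] [DecidableEq γ] :
    opsB α β γ = leftOps (equivBCA α β γ) := by
  refine congrArg Set.range (funext fun M => Matrix.ext fun i j => ?_)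
  rw [← Matrix.one_kronecker_one (m := γ) (n := α)]
  change (1 : Matrix α α ℂ) i.1 j.1 * (M i.2.1 j.2.1 * (1 : Matrix γ γ ℂ) i.2.2 j.2.2) =
    M i.2.1 j.2.1 * ((1 : Matrix γ γ ℂ) i.2.2 j.2.2 * (1 : Matrix α α ℂ) i.1 j.1)
  ring

theorem opsCA_eq_rightOps [DecidableEq β] : opsCA α β γ = rightOps (equivBCA α β γ) :=
  congrArg Set.range (funext fun _ => Matrix.ext fun _ _ => mul_comm _ _)

theorem opsC_eq_leftOps [DecidableEq α] [DecidableEq β] :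
    opsC α β γ = leftOps (equivCAB α β γ) := by
  refine congrArg Set.range (funext fun M => Matrix.ext fun i j => ?_)
  rw [← Matrix.one_kronecker_one (m := α) (n := β)]
  change (1 : Matrix α α ℂ) i.1 j.1 * ((1 : Matrix β β ℂ) i.2.1 j.2.1 * M i.2.2 j.2.2) =
    M i.2.2 j.2.2 * ((1 : Matrix α α ℂ) i.1 j.1 * (1 : Matrix β β ℂ) i.2.1 j.2.1)
  ring

theorem opsAB_eq_rightOps [DecidableEq γ] : opsAB α β γ = rightOps (equivCAB α β γ) :=
  congrArg Set.range (funext fun _ => Matrix.ext fun _ _ => mul_comm _ _)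

theorem opsA_subset_opsAB [DecidableEq β] [DecidableEq γ] : opsA α β γ ⊆ opsAB α β γ := by
  rintro _ ⟨M, rfl⟩
  exact ⟨M ⊗ₖ 1, Matrix.ext fun i j => mul_assoc _ _ _⟩

theorem opsB_subset_opsBC [DecidableEq α] [DecidableEq γ] : opsB α β γ ⊆ opsBC α β γ := by
  rintro _ ⟨M, rfl⟩
  exact ⟨M ⊗ₖ 1, rfl⟩

theorem opsC_subset_opsBC [DecidableEq α] [DecidableEq β] : opsC α β γ ⊆ opsBC α β γ := by
  rintro _ ⟨M, rfl⟩
  exact ⟨1 ⊗ₖ M, rfl⟩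

theorem opsC_subset_opsCA [DecidableEq α] [DecidableEq β] : opsC α β γ ⊆ opsCA α β γ := by
  rintro _ ⟨M, rfl⟩
  refine ⟨M ⊗ₖ 1, Matrix.ext fun i j => ?_⟩
  change M i.2.2 j.2.2 * (1 : Matrix α α ℂ) i.1 j.1 * (1 : Matrix β β ℂ) i.2.1 j.2.1 =
    (1 : Matrix α α ℂ) i.1 j.1 * ((1 : Matrix β β ℂ) i.2.1 j.2.1 * M i.2.2 j.2.2)
  ring

variable {α β γ} [Fintype α] [Fintype β] [Fintype γ]
  [DecidableEq α] [DecidableEq β] [DecidableEq γ]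

/-- It suffices that the joint measurements of any two parties are trivial: a measurement by one
party is a special case. -/
theorem irreducibleInEveryBipartition_of_isRigid {I : Type*} {ψ : I → α × β × γ → ℂ}
    {Q : Matrix (α × β × γ) (α × β × γ) ℂ} (hQ : Qᴴ = Q) (hQQ : Q * Q = Q) (hmem : Q ∈ opsC α β γ)
    (hψ : ∀ i, Q *ᵥ ψ i = ψ i) (hBC : IsRigid (opsBC α β γ) Q ψ) (hCA : IsRigid (opsCA α β γ) Q ψ)
    (hAB : IsRigid (opsAB α β γ) Q ψ) (horth : IsOrthogonalSet ψ) :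
    IrreducibleInEveryBipartition ψ := by
  have hA := hAB.mono (opsA_subset_opsAB α β γ)
  have hB := hBC.mono (opsB_subset_opsBC α β γ)
  have hC := hBC.mono (opsC_subset_opsBC α β γ)
  have sA : IsSplitting (opsA α β γ) (opsBC α β γ) Q := by
    rw [opsA_eq_leftOps, opsBC_eq_rightOps]
    exact isSplitting_leftOps_rightOps _ hQ hQQ (Or.inr (opsC_subset_opsBC α β γ hmem))
  have sB : IsSplitting (opsB α β γ) (opsCA α β γ) Q := by
    rw [opsB_eq_leftOps, opsCA_eq_rightOps]
    exact isSplitting_leftOps_rightOps _ hQ hQQ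
      (Or.inr (opsCA_eq_rightOps α β γ ▸ opsC_subset_opsCA α β γ hmem))
  have sC : IsSplitting (opsC α β γ) (opsAB α β γ) Q := by
    rw [opsC_eq_leftOps, opsAB_eq_rightOps]
    exact isSplitting_leftOps_rightOps _ hQ hQQ (Or.inl (opsC_eq_leftOps α β γ ▸ hmem))
  intro b
  fin_cases b
  · exact locallyIrreducible_of_isRigid sA hψ hA hBC horth
  · exact locallyIrreducible_of_isRigid sB hψ hB hCA horth
  · exact locallyIrreducible_of_isRigid sC hψ hC hAB horth

end Tripartite

/-! ### The states as integer vectors -/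

/-- The complex vector with the given integer entries. -/
def castVec {T : Type*} (v : T → ℤ) : T → ℂ := fun t => (v t : ℂ)

theorem castVec_eq_zero {T : Type*} {v : T → ℤ} : castVec v = 0 ↔ v = 0 := by
  simp [castVec, funext_iff]

theorem castVec_mul {T : Type*} (v w : T → ℤ) : castVec (v * w) = castVec v * castVec w := by
  ext; simp [castVec]

theorem star_castVec_dotProduct {T : Type*} [Fintype T] (v w : T → ℤ) :
    star (castVec v) ⬝ᵥ castVec w = ((v ⬝ᵥ w : ℤ) : ℂ) := by
  simp [castVec, dotProduct]

/-- Standard basis vector with integer entries. -/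
def intKet {n : ℕ} (k : Fin n) : Fin n → ℤ := fun j => if j = k then 1 else 0

/-- The states of Alice in `G4`. -/
def alice : Fin 27 → Fin 3 → ℤ :=
  let e := intKet
  ![e 0, e 0, e 0, e 0, e 1, e 1, e 2, e 2,
    e 0, e 1, e 1, e 2, e 2, e 2, e 2, e 1, e 1,
    e 1, e 0 + e 1, e 0 - e 1, e 0 + e 2, e 0 - e 2, e 0 + e 1, e 0 - e 1, e 0 + e 2, e 0 - e 2,
    e 2]

/-- The states of Bob in `G4`. -/
def bob : Fin 27 → Fin 3 → ℤ :=
  let e := intKet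
  ![e 1, e 1, e 2, e 2, e 2, e 2, e 1, e 1,
    e 0, e 0 + e 1, e 0 - e 1, e 0 + e 2, e 0 - e 2, e 0 + e 1, e 0 - e 1, e 0 + e 2, e 0 - e 2,
    e 1, e 0, e 0, e 0, e 0, e 1, e 1, e 2, e 2,
    e 2]

/-- The states of Charlie in `G4`. -/
def charlie : Fin 27 → Fin 6 → ℤ :=
  let e := intKet
  ![e 0 + e 1 + e 4 + e 5, e 0 - e 1 + e 4 - e 5, e 0 + e 2 + e 4 + e 3, e 0 - e 2 + e 4 - e 3,
    e 0 + e 1 + e 4 + e 5, e 0 - e 1 + e 4 - e 5, e 0 + e 2 + e 4 + e 3, e 0 - e 2 + e 4 - e 3,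
    e 0 - e 4, e 0 - e 4, e 0 - e 4, e 0 - e 4, e 0 - e 4,
    e 1 - e 5, e 1 - e 5, e 2 - e 3, e 2 - e 3,
    e 1 - e 5, e 1 - e 5, e 1 - e 5, e 2 - e 3, e 2 - e 3, e 2 - e 3, e 2 - e 3,
    e 1 - e 5, e 1 - e 5, e 2 - e 3]

/-- The support of Charlie's states after outcome `o` of his measurement, as a 0-1 vector. -/
def mask : Fin 2 → Fin 6 → ℤ := ![![1, 1, 1, 0, 0, 0], ![0, 0, 0, 1, 1, 1]]

/-- The product vector `a ⊗ b ⊗ c` with integer entries. -/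
def intProd3 {α β γ : Type*} (a : α → ℤ) (b : β → ℤ) (c : γ → ℤ) : α × β × γ → ℤ :=
  fun x => a x.1 * b x.2.1 * c x.2.2

theorem castVec_intProd3 {α β γ : Type*} (a : α → ℤ) (b : β → ℤ) (c : γ → ℤ) :
    castVec (intProd3 a b c) = prod3 (castVec a) (castVec b) (castVec c) := by
  ext; simp [castVec, intProd3, prod3]

theorem intProd3_dotProduct {α β γ : Type*} [Fintype α] [Fintype β] [Fintype γ] (a a' : α → ℤ)
    (b b' : β → ℤ) (c c' : γ → ℤ) :
    intProd3 a b c ⬝ᵥ intProd3 a' b' c' = (a ⬝ᵥ a') * (b ⬝ᵥ b') * (c ⬝ᵥ c') := by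
  simp only [dotProduct, intProd3, Fintype.sum_prod_type]
  rw [Finset.sum_mul_sum, Finset.sum_mul]
  refine Finset.sum_congr rfl fun _ _ => ?_
  rw [Finset.sum_mul]
  refine Finset.sum_congr rfl fun _ _ => ?_
  rw [Finset.mul_sum]
  exact Finset.sum_congr rfl fun _ _ => by ring

theorem kronecker_mulVec_prod3 {α β γ : Type*} [Fintype α] [Fintype β] [Fintype γ]
    (L : Matrix α α ℂ) (M : Matrix β β ℂ) (N : Matrix γ γ ℂ) (a : α → ℂ) (b : β → ℂ) (c : γ → ℂ) :
    (L ⊗ₖ (M ⊗ₖ N)) *ᵥ prod3 a b c = prod3 (L *ᵥ a) (M *ᵥ b) (N *ᵥ c) := by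
  ext x
  simp only [Matrix.mulVec, dotProduct, prod3, Fintype.sum_prod_type, Matrix.kroneckerMap_apply]
  rw [Finset.sum_mul_sum, Finset.sum_mul]
  refine Finset.sum_congr rfl fun _ _ => ?_
  rw [Finset.sum_mul]
  refine Finset.sum_congr rfl fun _ _ => ?_
  rw [Finset.mul_sum]
  exact Finset.sum_congr rfl fun _ _ => by ring

theorem G4_eq (i : Fin 27) :
    G4 i = prod3 (castVec (alice i)) (castVec (bob i)) (castVec (charlie i)) := by
  have hket : ∀ {n : ℕ} (k : Fin n), ket k = castVec (intKet k) := fun k => by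
    ext j; simp [ket, castVec, intKet, Pi.single_apply]
  have hadd : ∀ {n : ℕ} (v w : Fin n → ℤ), castVec v + castVec w = castVec (v + w) := fun v w => by
    ext; simp [castVec]
  have hsub : ∀ {n : ℕ} (v w : Fin n → ℤ), castVec v - castVec w = castVec (v - w) := fun v w => by
    ext; simp [castVec]
  simp only [G4, hket, hadd, hsub]
  fin_cases i <;> rfl

theorem onCharlie_mulVec_prod3 (M : Matrix (Fin 6) (Fin 6) ℂ) (a b : Fin 3 → ℂ) (c : Fin 6 → ℂ) :
    onCharlie M *ᵥ prod3 a b c = prod3 a b (M *ᵥ c) := by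
  rw [onCharlie, kronecker_mulVec_prod3, Matrix.one_mulVec, Matrix.one_mulVec]

theorem charlieMeasurement_eq (o : Fin 2) :
    charlieMeasurement o = onCharlie (Matrix.diagonal (castVec (mask o))) := by
  have h : ∀ o, castVec (mask o) = (![![1, 1, 1, 0, 0, 0], ![0, 0, 0, 1, 1, 1]] : Fin 2 → _) o := by
    intro o
    ext k
    fin_cases o <;> fin_cases k <;> simp [castVec, mask]
  rw [h]
  fin_cases o <;> rfl

theorem postMeasurement_eq_prod3 (o : Fin 2) (i : Fin 27) :
    postMeasurement o i =
      prod3 (castVec (alice i)) (castVec (bob i)) (castVec (mask o * charlie i)) := by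
  rw [postMeasurement, charlieMeasurement_eq, G4_eq, onCharlie_mulVec_prod3, castVec_mul]
  congr 1
  ext k
  rw [Matrix.mulVec_diagonal]
  rfl

/-- The states after outcome `o`, as integer vectors. -/
def postState (o : Fin 2) (i : Fin 27) : Fin 3 × Fin 3 × Fin 6 → ℤ :=
  intProd3 (alice i) (bob i) (mask o * charlie i)

theorem postMeasurement_eq (o : Fin 2) (i : Fin 27) :
    postMeasurement o i = castVec (postState o i) := by
  rw [postMeasurement_eq_prod3, postState, castVec_intProd3]

theorem isOrthogonalSet_castVec_intProd3 {I : Type*} {ψ : I → Fin 3 × Fin 3 × Fin 6 → ℂ}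
    {a b : I → Fin 3 → ℤ} {c : I → Fin 6 → ℤ} (hψ : ∀ i, ψ i = castVec (intProd3 (a i) (b i) (c i)))
    (h0 : ∀ i, (a i ⬝ᵥ a i) * (b i ⬝ᵥ b i) * (c i ⬝ᵥ c i) ≠ 0)
    (h : ∀ i j, i ≠ j → (a i ⬝ᵥ a j) * (b i ⬝ᵥ b j) * (c i ⬝ᵥ c j) = 0) : IsOrthogonalSet ψ := by
  refine ⟨fun i hi => h0 i ?_, fun i j hij => ?_⟩
  · rw [hψ, castVec_eq_zero] at hi
    rw [← intProd3_dotProduct, hi, zero_dotProduct]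
  · rw [hψ, hψ, star_castVec_dotProduct, intProd3_dotProduct, h i j hij, Int.cast_zero]

theorem isOrthogonalSet_G4 : IsOrthogonalSet G4 :=
  isOrthogonalSet_castVec_intProd3 (fun i => (G4_eq i).trans (castVec_intProd3 _ _ _).symm)
    (by decide +kernel) (by decide +kernel)

theorem isOrthogonalSet_postMeasurement (o : Fin 2) : IsOrthogonalSet (postMeasurement o) :=
  isOrthogonalSet_castVec_intProd3 (postMeasurement_eq o)
    (by revert o; decide +kernel) (by revert o; decide +kernel)

/-! ### Charlie's measurement -/

theorem onCharlie_mul (M N : Matrix (Fin 6) (Fin 6) ℂ) :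
    onCharlie M * onCharlie N = onCharlie (M * N) := by
  simp [onCharlie, ← Matrix.mul_kronecker_mul]

theorem onCharlie_conjTranspose (M : Matrix (Fin 6) (Fin 6) ℂ) :
    (onCharlie M)ᴴ = onCharlie Mᴴ := by
  simp [onCharlie, Matrix.conjTranspose_kronecker]

theorem charlieMeasurement_isHermitian (o : Fin 2) :
    (charlieMeasurement o)ᴴ = charlieMeasurement o := by
  rw [charlieMeasurement_eq, onCharlie_conjTranspose, Matrix.diagonal_conjTranspose]
  congr 2
  ext
  simp [castVec]

theorem charlieMeasurement_mul_self (o : Fin 2) :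
    charlieMeasurement o * charlieMeasurement o = charlieMeasurement o := by
  have h : ∀ o k, mask o k * mask o k = mask o k := by decide
  rw [charlieMeasurement_eq, onCharlie_mul, Matrix.diagonal_mul_diagonal]
  congr 2
  ext k
  simp only [castVec]
  exact_mod_cast h o k

theorem charlieMeasurement_mem (o : Fin 2) :
    charlieMeasurement o ∈ opsC (Fin 3) (Fin 3) (Fin 6) :=
  ⟨_, (charlieMeasurement_eq o).symm⟩

theorem charlieMeasurement_mulVec_postMeasurement (o : Fin 2) (i : Fin 27) :
    charlieMeasurement o *ᵥ postMeasurement o i = postMeasurement o i := by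
  rw [postMeasurement, Matrix.mulVec_mulVec, charlieMeasurement_mul_self]

theorem isOPM_charlieMeasurement : IsOPM (opsC (Fin 3) (Fin 3) (Fin 6)) charlieMeasurement G4 where
  mem := charlieMeasurement_mem
  complete := by
    simp only [charlieMeasurement_isHermitian, charlieMeasurement_mul_self, Fin.sum_univ_two]
    simp only [charlieMeasurement, Matrix.cons_val_zero, Matrix.cons_val_one, onCharlie]
    rw [← Matrix.kronecker_add, ← Matrix.kronecker_add, Matrix.diagonal_add]
    have h : (fun k => (![1, 1, 1, 0, 0, 0] : Fin 6 → ℂ) k + ![0, 0, 0, 1, 1, 1] k) = 1 := by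
      ext k; fin_cases k <;> simp
    rw [h]
    simp
  orthogonal o := (isOrthogonalSet_postMeasurement o).2

/-- The unitary that takes the support `4, 5, 3` after outcome `1` to the support `0, 1, 2` after
outcome `0`, state by state up to a sign. -/
theorem exists_unitary_postMeasurement :
    ∃ W ∈ Matrix.unitaryGroup (Fin 6) ℂ, ∀ i, ∃ z : ℂ, ‖z‖ = 1 ∧
      onCharlie W *ᵥ postMeasurement 1 i = z • postMeasurement 0 i := by
  let σ : Equiv.Perm (Fin 6) := Equiv.swap 0 4 * Equiv.swap 1 5 * Equiv.swap 2 3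
  refine ⟨σ.permMatrix ℂ, ?_, fun i => ?_⟩
  · rw [Matrix.mem_unitaryGroup_iff, Matrix.star_eq_conjTranspose, Matrix.conjTranspose_permMatrix,
      ← Matrix.permMatrix_mul]
    simp
  · have h : ∀ i : Fin 27, ∃ z : ℤ, (z = 1 ∨ z = -1) ∧
        ∀ k, (mask 1 * charlie i) (σ k) = z * (mask 0 * charlie i) k := by
      intro i
      by_cases hi : i < 8
      · exact ⟨1, Or.inl rfl, by revert i; decide +kernel⟩
      · exact ⟨-1, Or.inr rfl, by revert i; decide +kernel⟩
    obtain ⟨z, hz, hk⟩ := h i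
    refine ⟨z, by rcases hz with rfl | rfl <;> simp, ?_⟩
    rw [postMeasurement_eq_prod3, postMeasurement_eq_prod3, onCharlie_mulVec_prod3,
      Matrix.permMatrix_mulVec]
    ext x
    have := congrArg (Int.cast (R := ℂ)) (hk x.2.2)
    simp only [prod3, Function.comp_apply, castVec, Pi.smul_apply, smul_eq_mul]
    rw [this]
    push_cast
    ring

/-! ### The domino tiling of the cube -/

/-- The domino (two cells of the `3 × 3 × 3` cube that differ in one coordinate, not necessarily
neighbours) through a cell, named by the first of the two states
`|x⟩ + |y⟩`, `|x⟩ - |y⟩` (up to sign) that live on it.  The cells `000`, `111`, `222` are dominoes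
by themselves. -/
def domino (x : Fin 3 × Fin 3 × Fin 3) : Fin 27 :=
  (![![![8, 18, 20], ![0, 0, 22], ![2, 24, 2]],
     ![![9, 18, 15], ![9, 17, 22], ![4, 4, 15]],
     ![![11, 13, 20], ![6, 13, 6], ![11, 24, 26]]] : Fin 3 → Fin 3 → Fin 3 → Fin 27) x.1 x.2.1 x.2.2

/-- The second state on the domino through a cell (the first one again if the domino is a single
cell). -/
def domino' (x : Fin 3 × Fin 3 × Fin 3) : Fin 27 :=
  if domino x = 8 ∨ domino x = 17 ∨ domino x = 26 then domino x else domino x + 1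

/-- The basis vector of the full system that cell `x` stands for after outcome `o`: Charlie's levels
`0, 1, 2` become `4, 5, 3` after outcome `1`. -/
def cell (o : Fin 2) (x : Fin 3 × Fin 3 × Fin 3) : Fin 3 × Fin 3 × Fin 6 :=
  (x.1, x.2.1, (![![0, 1, 2], ![4, 5, 3]] : Fin 2 → Fin 3 → Fin 6) o x.2.2)

theorem domino_ne (x y : Fin 3 × Fin 3 × Fin 3) (h : domino x ≠ domino y) :
    domino x ≠ domino' y ∧ domino' x ≠ domino y ∧ domino' x ≠ domino' y := by
  revert x y; decide +kernel

theorem domino_ne_domino' (x y : Fin 3 × Fin 3 × Fin 3) (hxy : x ≠ y) (h : domino x = domino y) :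
    domino x ≠ domino' x := by
  revert x y; decide +kernel

/-- `2 |x⟩` is the sum or difference of the two states on the domino through `x`, up to sign. -/
theorem two_smul_single_cell (o : Fin 2) (x : Fin 3 × Fin 3 × Fin 3) :
    ∃ u v : ℂ, star u * u = 1 ∧ star v * v = 1 ∧ (2 : ℂ) • Pi.single (cell o x) (1 : ℂ) =
      u • postMeasurement o (domino x) + v • postMeasurement o (domino' x) := by
  have h : ∀ o x t, 2 * (if t = cell o x then 1 else 0) =
      postState o (domino x) (cell o x) * postState o (domino x) t +
      postState o (domino' x) (cell o x) * postState o (domino' x) t := by decide +kernel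
  have h1 : ∀ o x, postState o (domino x) (cell o x) * postState o (domino x) (cell o x) = 1 ∧
      postState o (domino' x) (cell o x) * postState o (domino' x) (cell o x) = 1 := by
    decide +kernel
  refine ⟨(postState o (domino x) (cell o x) : ℤ), (postState o (domino' x) (cell o x) : ℤ),
    ?_, ?_, ?_⟩
  · rw [star_intCast]; exact_mod_cast (h1 o x).1
  · rw [star_intCast]; exact_mod_cast (h1 o x).2
  · ext t
    simp only [postMeasurement_eq, castVec, Pi.smul_apply, Pi.add_apply, smul_eq_mul,
      Pi.single_apply]
    exact_mod_cast h o x t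

/-! ### Rigidity of the states after Charlie's measurement -/

section Rigidity

variable {o : Fin 2} {E : Matrix (Fin 3 × Fin 3 × Fin 6) (Fin 3 × Fin 3 × Fin 6) ℂ}

theorem four_mul_apply_cell {x y : Fin 3 × Fin 3 × Fin 3} {v w : Fin 3 × Fin 3 × Fin 6 → ℂ}
    (hx : (2 : ℂ) • Pi.single (cell o x) (1 : ℂ) = v)
    (hy : (2 : ℂ) • Pi.single (cell o y) (1 : ℂ) = w) :
    4 * E (cell o x) (cell o y) = star v ⬝ᵥ (E *ᵥ w) := by
  rw [← hx, ← hy, Matrix.mulVec_smul, Matrix.mulVec_single_one, star_smul, smul_dotProduct,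
    dotProduct_smul, ← Pi.single_star, star_one, single_one_dotProduct]
  simp only [star_ofNat, smul_eq_mul, Matrix.col_apply]
  ring

/-- Matrix elements between different dominoes vanish. -/
theorem apply_cell_eq_zero
    (hE : ∀ i j, i ≠ j → star (postMeasurement o i) ⬝ᵥ (E *ᵥ postMeasurement o j) = 0)
    {x y : Fin 3 × Fin 3 × Fin 3} (h : domino x ≠ domino y) : E (cell o x) (cell o y) = 0 := by
  obtain ⟨u, v, -, -, hx⟩ := two_smul_single_cell o x
  obtain ⟨u', v', -, -, hy⟩ := two_smul_single_cell o y
  obtain ⟨h1, h2, h3⟩ := domino_ne x y h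
  have := four_mul_apply_cell (E := E) hx hy
  simpa [Matrix.mulVec_add, Matrix.mulVec_smul, hE _ _ h, hE _ _ h1, hE _ _ h2, hE _ _ h3]
    using this

/-- The two diagonal matrix elements on a domino agree. -/
theorem apply_cell_eq
    (hE : ∀ i j, i ≠ j → star (postMeasurement o i) ⬝ᵥ (E *ᵥ postMeasurement o j) = 0)
    {x y : Fin 3 × Fin 3 × Fin 3} (h : domino x = domino y) :
    E (cell o x) (cell o x) = E (cell o y) (cell o y) := by
  rcases eq_or_ne x y with rfl | hxy
  · rfl
  have hne := domino_ne_domino' x y hxy h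
  have h' : domino' x = domino' y := by simp only [domino', h]
  have key : ∀ z, domino z = domino x → domino' z = domino' x →
      4 * E (cell o z) (cell o z) =
        star (postMeasurement o (domino x)) ⬝ᵥ (E *ᵥ postMeasurement o (domino x)) +
        star (postMeasurement o (domino' x)) ⬝ᵥ (E *ᵥ postMeasurement o (domino' x)) := by
    intro z hz hz'
    obtain ⟨u, v, hu, hv, hs⟩ := two_smul_single_cell o z
    rw [hz, hz'] at hs
    rw [four_mul_apply_cell hs hs]
    simp only [Matrix.mulVec_add, Matrix.mulVec_smul, star_add, star_smul, add_dotProduct,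
      dotProduct_add, smul_dotProduct, dotProduct_smul, hE _ _ hne, hE _ _ hne.symm, smul_eq_mul]
    linear_combination
      (star (postMeasurement o (domino x)) ⬝ᵥ (E *ᵥ postMeasurement o (domino x))) * hu +
      (star (postMeasurement o (domino' x)) ⬝ᵥ (E *ᵥ postMeasurement o (domino' x))) * hv
  have := (key x rfl rfl).trans (key y h.symm h'.symm).symm
  exact mul_left_cancel₀ (by norm_num) this

/-- Two positions `u`, `v` in a face of the cube are linked if dominoes over them coincide. -/
def IsLinked (r : Fin 3 → Fin 3 × Fin 3 → Fin 3 × Fin 3 × Fin 3) (u v : Fin 3 × Fin 3) : Prop :=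
  ∃ s t, domino (r s u) = domino (r t v)

instance (r : Fin 3 → Fin 3 × Fin 3 → Fin 3 × Fin 3 × Fin 3) (u v : Fin 3 × Fin 3) :
    Decidable (IsLinked r u v) :=
  inferInstanceAs (Decidable (∃ s t, domino (r s u) = domino (r t v)))

/-- If an operator of two parties, written in coordinates `r s u` (`s` for the idle party), leaves
the states orthogonal, it is a scalar provided that any two positions `u ≠ v` lie on different
dominoes in some layer `s`, and every position is linked to `(0, 0)`. -/
theorem isRigid_of_layers (o : Fin 2)
    {A : Set (Matrix (Fin 3 × Fin 3 × Fin 6) (Fin 3 × Fin 3 × Fin 6) ℂ)}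
    (r : Fin 3 → Fin 3 × Fin 3 → Fin 3 × Fin 3 × Fin 3) (hr : ∀ x, ∃ s u, r s u = x)
    (hoff : ∀ u v, u ≠ v → ∃ s, domino (r s u) ≠ domino (r s v))
    (hdiag : ∀ u, ∃ v w, IsLinked r u v ∧ IsLinked r v w ∧ IsLinked r w (0, 0))
    (hA : ∀ E ∈ A, ∃ M : Matrix (Fin 3 × Fin 3) (Fin 3 × Fin 3) ℂ, ∀ s t u v,
      E (cell o (r s u)) (cell o (r t v)) = if s = t then M u v else 0) :
    IsRigid A (charlieMeasurement o) (postMeasurement o) := by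
  intro E hEA hE
  obtain ⟨M, hM⟩ := hA E hEA
  have hM0 : ∀ u v, u ≠ v → M u v = 0 := fun u v huv => by
    obtain ⟨s, hs⟩ := hoff u v huv
    have := apply_cell_eq_zero hE hs
    rwa [hM, if_pos rfl] at this
  have hlink : ∀ u v, IsLinked r u v → M u u = M v v := fun u v ⟨s, t, hst⟩ => by
    have := apply_cell_eq hE hst
    rwa [hM, hM, if_pos rfl, if_pos rfl] at this
  have hM1 : ∀ u, M u u = M (0, 0) (0, 0) := fun u => by
    obtain ⟨v, w, h1, h2, h3⟩ := hdiag u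
    rw [hlink _ _ h1, hlink _ _ h2, hlink _ _ h3]
  have hcell : ∀ x y, E (cell o x) (cell o y) = if x = y then M (0, 0) (0, 0) else 0 := by
    intro x y
    by_cases hxy : x = y
    · obtain ⟨s, u, rfl⟩ := hr x
      rw [← hxy, hM, if_pos rfl, if_pos rfl, hM1]
    · obtain ⟨s, u, rfl⟩ := hr x
      obtain ⟨t, v, rfl⟩ := hr y
      rw [hM, if_neg hxy]
      split_ifs with hst
      · exact hM0 u v fun huv => hxy (by rw [hst, huv])
      · rfl
  -- The support of the states is spanned by the cells.
  have hsupp : ∀ o x, (∃ y, cell o y = x) ∨ mask o x.2.2 = 0 := by decide +kernel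
  have hQ : charlieMeasurement o = Matrix.diagonal fun x => (mask o x.2.2 : ℂ) := by
    rw [charlieMeasurement_eq, onCharlie, ← Matrix.diagonal_one,
      Matrix.diagonal_kronecker_diagonal, Matrix.diagonal_kronecker_diagonal]
    simp [castVec]
  have hmask : ∀ o k, mask o k * mask o k = mask o k := by decide
  have hinj : ∀ o x y, cell o x = cell o y → x = y := by decide +kernel
  refine ⟨M (0, 0) (0, 0), Matrix.ext fun x y => ?_⟩
  rw [hQ, Matrix.mul_diagonal, Matrix.diagonal_mul, Matrix.smul_apply, Matrix.diagonal_apply]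
  rcases hsupp o x with ⟨x, rfl⟩ | hx
  · rcases hsupp o y with ⟨y, rfl⟩ | hy
    · rw [hcell]
      by_cases hxy : x = y
      · subst hxy
        have : (mask o (cell o x).2.2 : ℂ) * mask o (cell o x).2.2 = mask o (cell o x).2.2 := by
          exact_mod_cast hmask o _
        simp only [if_true, smul_eq_mul]
        linear_combination M (0, 0) (0, 0) * this
      · rw [if_neg hxy, if_neg fun h => hxy (hinj o _ _ h)]
        simp
    · rw [hy]
      split_ifs with hxy
      · rw [hxy, hy]; simp
      · simp
  · simp [hx]

theorem isRigid_opsBC (o : Fin 2) :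
    IsRigid (opsBC (Fin 3) (Fin 3) (Fin 6)) (charlieMeasurement o) (postMeasurement o) := by
  refine isRigid_of_layers o (fun s u => (s, u.1, u.2)) (fun x => ⟨x.1, x.2, rfl⟩)
    (by decide +kernel) (by decide +kernel) ?_
  rintro _ ⟨M, rfl⟩
  refine ⟨fun u v => M (cell o (0, u)).2 (cell o (0, v)).2, fun s t u v => ?_⟩
  simp [cell, Matrix.one_apply]

theorem isRigid_opsCA (o : Fin 2) :
    IsRigid (opsCA (Fin 3) (Fin 3) (Fin 6)) (charlieMeasurement o) (postMeasurement o) := by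
  refine isRigid_of_layers o (fun s u => (u.2, s, u.1)) (fun x => ⟨x.2.1, (x.2.2, x.1), rfl⟩)
    (by decide +kernel) (by decide +kernel) ?_
  rintro _ ⟨M, rfl⟩
  refine ⟨fun u v => M ((cell o (0, 0, u.1)).2.2, u.2) ((cell o (0, 0, v.1)).2.2, v.2),
    fun s t u v => ?_⟩
  simp [cell, Matrix.one_apply]

theorem isRigid_opsAB (o : Fin 2) :
    IsRigid (opsAB (Fin 3) (Fin 3) (Fin 6)) (charlieMeasurement o) (postMeasurement o) := by
  refine isRigid_of_layers o (fun s u => (u.1, u.2, s)) (fun x => ⟨x.2.2, (x.1, x.2.1), rfl⟩)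
    (by decide +kernel) (by decide +kernel) ?_
  rintro _ ⟨M, rfl⟩
  refine ⟨M, fun s t u v => ?_⟩
  have hinj : ∀ o x y, (cell o x).2.2 = (cell o y).2.2 ↔ x.2.2 = y.2.2 := by decide +kernel
  simp only [Matrix.of_apply, Matrix.one_apply, hinj, mul_ite, mul_one, mul_zero]
  rfl

theorem irreducibleInEveryBipartition_postMeasurement (o : Fin 2) :
    IrreducibleInEveryBipartition (postMeasurement o) :=
  irreducibleInEveryBipartition_of_isRigid (charlieMeasurement_isHermitian o)
    (charlieMeasurement_mul_self o) (charlieMeasurement_mem o)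
    (charlieMeasurement_mulVec_postMeasurement o) (isRigid_opsBC o) (isRigid_opsCA o)
    (isRigid_opsAB o) (isOrthogonalSet_postMeasurement o)

end Rigidity

/-! ### A local protocol that distinguishes the states -/

section Protocol

/-- Two-outcome projective measurements suffice to build a protocol. -/
theorem LocallyDistinguishable.of_projection {T I P : Type*} [Fintype T] [DecidableEq T]
    {ops : P → Set (Matrix T T ℂ)} {ψ : I → T → ℂ} (p : P) {R : Matrix T T ℂ} (hR : R ∈ ops p)
    (hR' : 1 - R ∈ ops p) (hherm : Rᴴ = R) (hidem : R * R = R)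
    (h1 : LocallyDistinguishable ops fun i => R *ᵥ ψ i)
    (h0 : LocallyDistinguishable ops fun i => (1 - R) *ᵥ ψ i) : LocallyDistinguishable ops ψ := by
  refine .step ψ p ![R, 1 - R] ⟨fun o => ?_, ?_⟩ fun o => ?_
  · fin_cases o
    exacts [hR, hR']
  · simp [Fin.sum_univ_two, hherm, sub_mul, mul_sub, hidem]
  · fin_cases o
    exacts [h1, h0]

/-- The orthogonal projection onto the line spanned by an integer vector (`0` for `v = 0`). -/
noncomputable def lineProj {n : ℕ} (v : Fin n → ℤ) : Matrix (Fin n) (Fin n) ℂ :=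
  ((v ⬝ᵥ v : ℤ) : ℂ)⁻¹ • Matrix.vecMulVec (castVec v) (castVec v)

theorem castVec_dotProduct {T : Type*} [Fintype T] (v w : T → ℤ) :
    castVec v ⬝ᵥ castVec w = ((v ⬝ᵥ w : ℤ) : ℂ) := by
  simp [castVec, dotProduct]

variable {n : ℕ} {v w : Fin n → ℤ}

theorem lineProj_mulVec (v w : Fin n → ℤ) :
    lineProj v *ᵥ castVec w = (((v ⬝ᵥ v : ℤ) : ℂ)⁻¹ * ((v ⬝ᵥ w : ℤ) : ℂ)) • castVec v := by
  rw [lineProj, Matrix.smul_mulVec, Matrix.vecMulVec_mulVec, castVec_dotProduct, op_smul_eq_smul,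
    smul_smul]

theorem lineProj_mulVec_self (hv : v ≠ 0) : lineProj v *ᵥ castVec v = castVec v := by
  rw [lineProj_mulVec, inv_mul_cancel₀, one_smul]
  exact_mod_cast fun h => hv (dotProduct_self_eq_zero.mp h)

theorem lineProj_mulVec_of_orthogonal (h : v ⬝ᵥ w = 0) : lineProj v *ᵥ castVec w = 0 := by
  rw [lineProj_mulVec, h]
  simp

theorem lineProj_conjTranspose (v : Fin n → ℤ) : (lineProj v)ᴴ = lineProj v := by
  ext i j
  simp [lineProj, Matrix.vecMulVec_apply, castVec, mul_comm]

theorem lineProj_mul_self (v : Fin n → ℤ) : lineProj v * lineProj v = lineProj v := by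
  by_cases hv : v = 0
  · simp [lineProj, hv]
  have h : lineProj v * Matrix.vecMulVec (castVec v) (castVec v) =
      Matrix.vecMulVec (castVec v) (castVec v) := by
    rw [Matrix.mul_vecMulVec, lineProj_mulVec_self hv]
  nth_rw 2 [lineProj]
  rw [mul_smul_comm, h, lineProj]

/-- The states `G4 i`, `i ∈ S`, can be distinguished; the others have been excluded. -/
def Distinguishable (S : Finset (Fin 27)) : Prop :=
  LocallyDistinguishable (separated (Fin 3) (Fin 3) (Fin 6)) fun i => if i ∈ S then G4 i else 0

theorem Distinguishable.of_card_le_one {S : Finset (Fin 27)} (h : S.card ≤ 1) :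
    Distinguishable S := by
  refine .done _ fun i j hij => ?_
  by_cases hi : i ∈ S
  · exact Or.inr (if_neg fun hj => hij (Finset.card_le_one.mp h i hi j hj))
  · exact Or.inl (if_neg hi)

theorem Distinguishable.of_projection {S : Finset (Fin 27)} (p : Fin 3)
    {R : Matrix (Fin 3 × Fin 3 × Fin 6) (Fin 3 × Fin 3 × Fin 6) ℂ}
    (hR : R ∈ separated (Fin 3) (Fin 3) (Fin 6) p)
    (hR' : 1 - R ∈ separated (Fin 3) (Fin 3) (Fin 6) p) (hherm : Rᴴ = R) (hidem : R * R = R)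
    (q : Fin 27 → Prop) [DecidablePred q]
    (hq : ∀ i ∈ S, R *ᵥ G4 i = if q i then G4 i else 0)
    (h1 : Distinguishable (S.filter q)) (h0 : Distinguishable (S.filter fun i => ¬ q i)) :
    Distinguishable S := by
  refine LocallyDistinguishable.of_projection p hR hR' hherm hidem ?_ ?_
  · unfold Distinguishable at h1
    convert h1 using 2 with i
    by_cases hi : i ∈ S <;> simp [hi, hq]
  · unfold Distinguishable at h0
    convert h0 using 2 with i
    by_cases hi : i ∈ S
    · by_cases hqi : q i <;> simp [hi, hq, hqi, Matrix.sub_mulVec]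
    · simp [hi]

/-- Alice projects onto `v` or its complement; every remaining state is `v` or orthogonal to `v` at
her site, and so survives in exactly one of the two branches. -/
theorem Distinguishable.of_alice {S : Finset (Fin 27)} (v : Fin 3 → ℤ) (hv : v ≠ 0)
    (h : ∀ i ∈ S, alice i = v ∨ v ⬝ᵥ alice i = 0)
    (h1 : Distinguishable (S.filter fun i => alice i = v))
    (h0 : Distinguishable (S.filter fun i => ¬ alice i = v)) : Distinguishable S := by
  refine .of_projection 0 (R := lineProj v ⊗ₖ (1 ⊗ₖ 1)) ⟨lineProj v, rfl⟩ ⟨1 - lineProj v, ?_⟩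
    ?_ ?_ (fun i => alice i = v) (fun i hi => ?_) h1 h0
  · dsimp only
    rw [eq_sub_iff_add_eq, ← Matrix.add_kronecker, sub_add_cancel]
    simp
  · simp [Matrix.conjTranspose_kronecker, lineProj_conjTranspose]
  · simp [← Matrix.mul_kronecker_mul, lineProj_mul_self]
  · rw [G4_eq, kronecker_mulVec_prod3, Matrix.one_mulVec, Matrix.one_mulVec]
    split_ifs with hiv
    · rw [hiv, lineProj_mulVec_self hv]
    · rw [lineProj_mulVec_of_orthogonal ((h i hi).resolve_left hiv)]
      ext; simp [prod3]

theorem Distinguishable.of_bob {S : Finset (Fin 27)} (v : Fin 3 → ℤ) (hv : v ≠ 0)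
    (h : ∀ i ∈ S, bob i = v ∨ v ⬝ᵥ bob i = 0)
    (h1 : Distinguishable (S.filter fun i => bob i = v))
    (h0 : Distinguishable (S.filter fun i => ¬ bob i = v)) : Distinguishable S := by
  refine .of_projection 1 (R := 1 ⊗ₖ (lineProj v ⊗ₖ 1)) ⟨lineProj v, rfl⟩ ⟨1 - lineProj v, ?_⟩
    ?_ ?_ (fun i => bob i = v) (fun i hi => ?_) h1 h0
  · dsimp only
    rw [eq_sub_iff_add_eq, ← Matrix.kronecker_add, ← Matrix.add_kronecker, sub_add_cancel]
    simp
  · simp [Matrix.conjTranspose_kronecker, lineProj_conjTranspose]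
  · simp [← Matrix.mul_kronecker_mul, lineProj_mul_self]
  · rw [G4_eq, kronecker_mulVec_prod3, Matrix.one_mulVec, Matrix.one_mulVec]
    split_ifs with hiv
    · rw [hiv, lineProj_mulVec_self hv]
    · rw [lineProj_mulVec_of_orthogonal ((h i hi).resolve_left hiv)]
      ext; simp [prod3]

theorem Distinguishable.of_charlie {S : Finset (Fin 27)} (v : Fin 6 → ℤ) (hv : v ≠ 0)
    (h : ∀ i ∈ S, charlie i = v ∨ v ⬝ᵥ charlie i = 0)
    (h1 : Distinguishable (S.filter fun i => charlie i = v))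
    (h0 : Distinguishable (S.filter fun i => ¬ charlie i = v)) :
    Distinguishable S := by
  refine .of_projection 2 (R := 1 ⊗ₖ (1 ⊗ₖ lineProj v)) ⟨lineProj v, rfl⟩ ⟨1 - lineProj v, ?_⟩
    ?_ ?_ (fun i => charlie i = v) (fun i hi => ?_) h1 h0
  · dsimp only
    rw [eq_sub_iff_add_eq, ← Matrix.kronecker_add, ← Matrix.kronecker_add, sub_add_cancel]
    simp
  · simp [Matrix.conjTranspose_kronecker, lineProj_conjTranspose]
  · simp [← Matrix.mul_kronecker_mul, lineProj_mul_self]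
  · rw [G4_eq, kronecker_mulVec_prod3, Matrix.one_mulVec, Matrix.one_mulVec]
    split_ifs with hiv
    · rw [hiv, lineProj_mulVec_self hv]
    · rw [lineProj_mulVec_of_orthogonal ((h i hi).resolve_left hiv)]
      ext; simp [prod3]

/-- The states with Charlie in `|0⟩ - |4⟩`: Alice's level tells whether Bob has to distinguish
`|0⟩ ± |1⟩` or `|0⟩ ± |2⟩`. -/
theorem distinguishable_zero_sub_four : Distinguishable {8, 9, 10, 11, 12} := by
  refine .of_alice (intKet 0) (by decide) (by decide) (.of_card_le_one (by decide)) ?_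
  refine .of_alice (intKet 1) (by decide) (by decide) ?_ ?_
  · exact .of_bob (intKet 0 + intKet 1) (by decide) (by decide) (.of_card_le_one (by decide))
      (.of_card_le_one (by decide))
  · exact .of_bob (intKet 0 + intKet 2) (by decide) (by decide) (.of_card_le_one (by decide))
      (.of_card_le_one (by decide))

/-- The states with Charlie in `|1⟩ - |5⟩`: they live on disjoint dominoes of the `3 × 3` square
of Alice and Bob, and Bob and Alice can split the square between dominoes. -/
theorem distinguishable_one_sub_five : Distinguishable {13, 14, 17, 18, 19, 24, 25} := by
  refine .of_bob (intKet 2) (by decide) (by decide) ?_ ?_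
  · exact .of_alice (intKet 0 + intKet 2) (by decide) (by decide) (.of_card_le_one (by decide))
      (.of_card_le_one (by decide))
  refine .of_alice (intKet 2) (by decide) (by decide) ?_ ?_
  · exact .of_bob (intKet 0 + intKet 1) (by decide) (by decide) (.of_card_le_one (by decide))
      (.of_card_le_one (by decide))
  refine .of_bob (intKet 1) (by decide) (by decide) (.of_card_le_one (by decide)) ?_
  exact .of_alice (intKet 0 + intKet 1) (by decide) (by decide) (.of_card_le_one (by decide))
    (.of_card_le_one (by decide))

/-- The states with Charlie in `|2⟩ - |3⟩`: as before, with the levels `1` and `2` of Alice and Bob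
exchanged. -/
theorem distinguishable_two_sub_three : Distinguishable {15, 16, 20, 21, 22, 23, 26} := by
  refine .of_bob (intKet 1) (by decide) (by decide) ?_ ?_
  · exact .of_alice (intKet 0 + intKet 1) (by decide) (by decide) (.of_card_le_one (by decide))
      (.of_card_le_one (by decide))
  refine .of_alice (intKet 1) (by decide) (by decide) ?_ ?_
  · exact .of_bob (intKet 0 + intKet 2) (by decide) (by decide) (.of_card_le_one (by decide))
      (.of_card_le_one (by decide))
  refine .of_bob (intKet 2) (by decide) (by decide) (.of_card_le_one (by decide)) ?_
  exact .of_alice (intKet 0 + intKet 2) (by decide) (by decide) (.of_card_le_one (by decide))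
    (.of_card_le_one (by decide))

/-- The states with four terms at Charlie's site: the levels of Alice and Bob tell him which two
orthogonal states he has to distinguish. -/
theorem distinguishable_four_terms : Distinguishable {0, 1, 2, 3, 4, 5, 6, 7} := by
  have h1 : ∀ S : Finset (Fin 27), S = {0, 1} ∨ S = {4, 5} → Distinguishable S := by
    rintro _ (rfl | rfl) <;>
    exact .of_charlie (intKet 0 + intKet 1 + intKet 4 + intKet 5) (by decide) (by decide)
      (.of_card_le_one (by decide)) (.of_card_le_one (by decide))
  have h2 : ∀ S : Finset (Fin 27), S = {2, 3} ∨ S = {6, 7} → Distinguishable S := by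
    rintro _ (rfl | rfl) <;>
    exact .of_charlie (intKet 0 + intKet 2 + intKet 4 + intKet 3) (by decide) (by decide)
      (.of_card_le_one (by decide)) (.of_card_le_one (by decide))
  refine .of_alice (intKet 0) (by decide) (by decide) ?_ ?_
  · exact .of_bob (intKet 1) (by decide) (by decide) (h1 _ (by decide)) (h2 _ (by decide))
  · exact .of_bob (intKet 2) (by decide) (by decide) (h1 _ (by decide)) (h2 _ (by decide))

theorem locallyDistinguishable_G4 :
    LocallyDistinguishable (separated (Fin 3) (Fin 3) (Fin 6)) G4 := by
  have h : Distinguishable Finset.univ := by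
    refine .of_charlie (intKet 0 - intKet 4) (by decide) (by decide) ?_ ?_
    · convert distinguishable_zero_sub_four using 1
      decide
    refine .of_charlie (intKet 1 - intKet 5) (by decide) (by decide) ?_ ?_
    · convert distinguishable_one_sub_five using 1
      decide
    refine .of_charlie (intKet 2 - intKet 3) (by decide) (by decide) ?_ ?_
    · convert distinguishable_two_sub_three using 1
      decide
    · convert distinguishable_four_terms using 1
      decide
  simpa [Distinguishable] using h

end Protocol

end LocalStates

theorem theorem4 :
    -- the initial set: orthogonal product states, perfectly distinguishable by LOCC
    IsOrthogonalSet G4 ∧ (∀ i, IsProduct (G4 i)) ∧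
    LocallyDistinguishable (separated (Fin 3) (Fin 3) (Fin 6)) G4 ∧
    -- Charlie's measurement is a local orthogonality preserving measurement for it
    IsOPM (opsC (Fin 3) (Fin 3) (Fin 6)) charlieMeasurement G4 ∧
    -- each outcome leaves an orthogonal product set that is irreducible in every bipartition
    (∀ o, IsOrthogonalSet (postMeasurement o) ∧ (∀ i, IsProduct (postMeasurement o i)) ∧
      IrreducibleInEveryBipartition (postMeasurement o)) ∧
    -- and both outcomes leave the same set, up to a unitary of Charlie and phases
    (∃ W ∈ Matrix.unitaryGroup (Fin 6) ℂ, ∀ i, ∃ z : ℂ, ‖z‖ = 1 ∧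
      onCharlie W *ᵥ postMeasurement 1 i = z • postMeasurement 0 i) := by
  refine ⟨isOrthogonalSet_G4, fun i => ⟨_, _, _, G4_eq i⟩, locallyDistinguishable_G4,
    isOPM_charlieMeasurement, fun o => ⟨isOrthogonalSet_postMeasurement o,
      fun i => ⟨_, _, _, postMeasurement_eq_prod3 o i⟩,
      irreducibleInEveryBipartition_postMeasurement o⟩, exists_unitary_postMeasurement⟩
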